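/- Let $\lambda$ be Lebesgue measure on $[0,1]$ and let $(\Omega,\mathcal P)=\prod_{n=0}^\infty([0,1],\lambda)$. Let $B_1,B_2,\dots$ be pairwise disjoint measurable subsets of $[0,1]$ with $\lambda(B_n)=\frac1{e\,n!}$, and for $f\in L_1[0,1]$ let $$Kf(\omega_0,\omega_1,\dots)=\sum_{n=1}^\infty\sum_{k=1}^n f(\omega_k)\chi_{B_n}(\omega_0)$$ be the Kruglov operator. For a real measurable function $f$ on a probability space $(S,\mu)$ let $f^*(t)=\inf\{s\ge 0:\mu(|f|>s)\le t\}$ be its decreasing rearrangement, and for $p>1$ put $$\|f\|_{\Lambda(t^{1/p})}=\int_0^1 f^*(s)\,d(s^{1/p}),\qquad \|f\|_{M(t^{1/p})}=\sup_{0<t\le1}\frac{t^{1/p}}{t}\int_0^t f^*(s)\,ds .$$ The Lorentz space $\Lambda(t^{1/p})$ and the Marcinkiewicz space $M(t^{1/p})$ consist of the measurable functions for which the respective norm is finite. For $X=L_p$, $\Lambda(t^{1/p})$ or $M(t^{1/p})$, let $\|K\|_{X\to X}$ be the norm of $K$ as a linear operator from $X$ on $[0,1]$ into $X$ on $(\Omega,\mathcal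 P)$. **Theorem.** There are universal constants $0<\alpha\le\beta<\infty$ such that for every $p>1$ each of the norms $\|K\|_{L_p\to L_p}$, $\|K\|_{\Lambda(t^{1/p})\to\Lambda(t^{1/p})}$ and $\|K\|_{M(t^{1/p})\to M(t^{1/p})}$ lies in the interval $$\Bigl[\alpha\,\frac{p}{\ln(p+1)},\ \beta\,\frac{p}{\ln(p+1)}\Bigr].$$ -/

import Mathlib

open MeasureTheory Set
open scoped ENNReal

noncomputable section

/-- The decreasing rearrangement `f^*` of a function `f` on a measure space,
`f^*(t) = inf {s ≥ 0 : μ {|f| > s} ≤ t}`. -/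
def decRearr {Ω : Type*} [MeasurableSpace Ω] (μ : Measure Ω) (f : Ω → ℝ) (t : ℝ) : ℝ≥0∞ :=
  sInf {s : ℝ≥0∞ | μ {x | s < ‖f x‖ₑ} ≤ ENNReal.ofReal t}

/-- The function `ψ(t) = t^{1/p}`, extended by the value `0` to `t < 0`. -/
def rootFun (p : ℝ) (hp : 0 < p) : StieltjesFunction ℝ where
  toFun t := max t 0 ^ (1 / p)
  mono' := fun _ _ h =>
    Real.rpow_le_rpow (le_max_right _ _) (max_le_max_right 0 h) (by positivity)
  right_continuous' := fun x =>
    ((continuous_id.max continuous_const).rpow_const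
      (fun _ => Or.inr (by positivity))).continuousAt.continuousWithinAt

/-- The norm of the Lorentz space `Λ(ψ)`: the Lebesgue-Stieltjes integral `∫_0^1 f^* dψ`. -/
def lorentzNorm {Ω : Type*} [MeasurableSpace Ω] (μ : Measure Ω) (ψ : StieltjesFunction ℝ)
    (f : Ω → ℝ) : ℝ≥0∞ :=
  ∫⁻ s in Ioc (0 : ℝ) 1, decRearr μ f s ∂ψ.measure

/-- The norm of the Marcinkiewicz space `M(ψ)`: `sup_{0 < t ≤ 1} (ψ(t) / t) ∫_0^t f^*(s) ds`. -/
def marcinkiewiczNorm {Ω : Type*} [MeasurableSpace Ω] (μ : Measure Ω) (ψ : StieltjesFunction ℝ)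
    (f : Ω → ℝ) : ℝ≥0∞ :=
  ⨆ t ∈ Ioc (0 : ℝ) 1, ENNReal.ofReal (ψ t / t) * ∫⁻ s in Ioc (0 : ℝ) t, decRearr μ f s

/-- The product measure on `∏_{n ≥ 0} [0, 1]` of countably many copies of Lebesgue measure. -/
def cubeMeasure : Measure (ℕ → unitInterval) :=
  Measure.infinitePi fun _ : ℕ => (volume : Measure unitInterval)

/-- `B_1, B_2, …` are pairwise disjoint measurable subsets of `[0, 1]` with `λ(B_n) = 1 / (e n!)`.
(The set `B 0` is not used.) -/
structure IsPoissonSets (B : ℕ → Set unitInterval) : Prop where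
  measurableSet : ∀ n, 1 ≤ n → MeasurableSet (B n)
  disjoint : ∀ m n, 1 ≤ m → 1 ≤ n → m ≠ n → Disjoint (B m) (B n)
  volume_eq : ∀ n, 1 ≤ n →
    volume (B n) = ENNReal.ofReal (1 / (Real.exp 1 * (Nat.factorial n : ℝ)))

/-- The Kruglov operator
`K f (ω_0, ω_1, …) = ∑_{n ≥ 1} ∑_{k = 1}^n f (ω_k) χ_{B_n} (ω_0)`.
The term `n = 0` of the outer sum is an empty sum, and at every point at most one term is nonzero
when the sets `B_n`, `n ≥ 1`, are pairwise disjoint. -/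
def kruglov (B : ℕ → Set unitInterval) (f : unitInterval → ℝ) (ω : ℕ → unitInterval) : ℝ :=
  ∑' n : ℕ, ∑ k ∈ Finset.Icc 1 n, f (ω k) * (B n).indicator (fun _ => (1 : ℝ)) (ω 0)

/-- The norm `‖K‖_{X → Y}` of the Kruglov operator, where `X` and `Y` are the spaces of the
(a.e. classes of) measurable functions on `[0, 1]`, respectively on `∏_{n ≥ 0} [0, 1]`, whose
extended norms `NX`, respectively `NY`, are finite. It is the least constant `C` with
`‖K f‖_Y ≤ C ‖f‖_X` for all `f ∈ X`, and it is `∞` when there is no finite constant. -/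
def kruglovNorm (B : ℕ → Set unitInterval) (NX : (unitInterval → ℝ) → ℝ≥0∞)
    (NY : ((ℕ → unitInterval) → ℝ) → ℝ≥0∞) : ℝ≥0∞ :=
  sInf {C : ℝ≥0∞ | ∀ f : unitInterval → ℝ, AEMeasurable f volume → NX f < ∞ →
    AEMeasurable (kruglov B f) cubeMeasure ∧ NY (kruglov B f) ≤ C * NX f}

/-- `‖K‖_{L_p → L_p}`. -/
def kruglovNormLp (B : ℕ → Set unitInterval) (p : ℝ) : ℝ≥0∞ :=
  kruglovNorm B (fun f => eLpNorm f (ENNReal.ofReal p) volume)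
    (fun g => eLpNorm g (ENNReal.ofReal p) cubeMeasure)

/-- `‖K‖_{Λ(ψ) → Λ(ψ)}`. -/
def kruglovNormLorentz (B : ℕ → Set unitInterval) (ψ : StieltjesFunction ℝ) : ℝ≥0∞ :=
  kruglovNorm B (lorentzNorm volume ψ) (lorentzNorm cubeMeasure ψ)

/-- `‖K‖_{M(ψ) → M(ψ)}`. -/
def kruglovNormMarcinkiewicz (B : ℕ → Set unitInterval) (ψ : StieltjesFunction ℝ) : ℝ≥0∞ :=
  kruglovNorm B (marcinkiewiczNorm volume ψ) (marcinkiewiczNorm cubeMeasure ψ)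

end

/-! Let `N` be the Poisson variable that equals `n` on `{ω_0 ∈ B_n}`. Then `|K f|` is at most the sum
over `k ≥ 1` of the functions `χ_{N ≥ k}(ω_0) |f(ω_k)|`. Because `ω_0` and `ω_k` are independent, the
distribution function of the `k`-th summand is that of `f` multiplied by `P(N ≥ k)`
(`cubeMeasure_lt_kruglovTerm`), so its rearrangement is that of `f` dilated by `P(N ≥ k)`. In each
of the three spaces such a dilation by `a` has norm at most `a^{1/p}`
(`eLpNorm_dilation`, `lorentz_dilation`, `marcinkiewicz_dilation_le`), and the norm satisfies the
countable triangle inequality (`eLpNorm_tsum_le`, `lorentz_tsum_le`, `marcinkiewicz_tsum_le`). Hence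
in all three cases `‖K‖ ≤ ∑_k P(N ≥ k)^{1/p}` (`kruglovNorm_le_tsum`). Since `P(N ≥ k) ≤ 1 / k!`,
comparison with a geometric series bounds the sum by a multiple of `p / ln (p + 1)`
(`tsum_ofReal_rpow_le`).

The triangle inequalities of the Lorentz and Marcinkiewicz norms come from that of
`g ↦ ∫_0^t g^*` (`setLIntegral_rearr_tsum_le`), which is the minimum over `c` of
`t c + ∫ (g - c)_+`; for the Lorentz norm the measure `d(s^{1/p})` is a mixture of the Lebesgue
measures on the intervals `(0, τ]` (`setLIntegral_Ioi_rootFun`).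

For the lower bound take `f = 1`: `K 1 = n` on a set of measure `1 / (e n!)`, so in each of the
spaces `‖K‖` is at least `n (1 / (2 e n!))^{1/p}` (`le_kruglovNorm`), and `n = ⌈p / ln (p + 1)⌉`
gives the order `p / ln (p + 1)` (`exists_le_natCast_mul_rpow`). -/

/-! ### Decreasing rearrangements of `ℝ≥0∞`-valued functions -/

/-- The decreasing rearrangement of an `ℝ≥0∞`-valued function; `decRearr μ f` is, by definition,
the rearrangement of `fun x => ‖f x‖ₑ`. -/
noncomputable def rearr {Ω : Type*} [MeasurableSpace Ω] (μ : Measure Ω) (g : Ω → ℝ≥0∞) (t : ℝ) :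
    ℝ≥0∞ :=
  sInf {s : ℝ≥0∞ | μ {x | s < g x} ≤ ENNReal.ofReal t}

section Rearrangement

variable {Ω : Type*} [MeasurableSpace Ω] {μ : Measure Ω} {g h : Ω → ℝ≥0∞}

/-- The generalized-inverse relation between the rearrangement and the distribution function. It
holds because the distribution function is right continuous. -/
theorem lt_rearr_iff {s : ℝ≥0∞} {t : ℝ} :
    s < rearr μ g t ↔ ENNReal.ofReal t < μ {x | s < g x} := by
  rw [← not_le, ← not_le, not_iff_not]
  refine ⟨fun hs => ?_, fun hs => sInf_le hs⟩
  rcases eq_or_ne s ∞ with rfl | hs'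
  · simp
  obtain ⟨u, hanti, hu, hlim⟩ := exists_seq_strictAnti_tendsto' (lt_top_iff_ne_top.2 hs')
  have hset : {x | s < g x} = ⋃ n, {x | u n < g x} := by
    ext x
    simp only [mem_ofPred_eq, mem_iUnion]
    refine ⟨fun hx => ?_, fun ⟨n, hn⟩ => (hu n).1.trans hn⟩
    exact ((hlim.eventually_lt_const hx).exists)
  rw [hset]
  have hmono : Monotone fun n => {x | u n < g x} := fun m n hmn x hx =>
    lt_of_le_of_lt (hanti.antitone hmn) hx
  rw [hmono.measure_iUnion]
  refine iSup_le fun n => ?_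
  obtain ⟨v, hv, hvu⟩ := sInf_lt_iff.1 (hs.trans_lt (hu n).1)
  exact (measure_mono fun x hx => lt_trans hvu hx).trans hv

theorem rearr_antitone : Antitone (rearr μ g) := fun _ _ h =>
  sInf_le_sInf fun _ hs => le_trans hs (ENNReal.ofReal_le_ofReal h)

theorem measurable_rearr : Measurable (rearr μ g) := rearr_antitone.measurable

theorem rearr_mono (hgh : g ≤ h) (t : ℝ) : rearr μ g t ≤ rearr μ h t :=
  sInf_le_sInf fun _ hs => (measure_mono fun x hx => lt_of_lt_of_le hx (hgh x)).trans hs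

theorem rearr_eq_zero [IsProbabilityMeasure μ] {t : ℝ} (ht : 1 ≤ t) : rearr μ g t = 0 := by
  by_contra h0
  have := lt_rearr_iff.1 (pos_iff_ne_zero.2 h0)
  exact absurd (this.trans_le prob_le_one) (not_lt.2 (by simpa using ht))

/-- The layer cake formula for functions with values in `ℝ≥0∞`. -/
theorem lintegral_eq_lintegral_measure_lt {α : Type*} [MeasurableSpace α] {ν : Measure α}
    [SFinite ν] {φ : α → ℝ≥0∞} (hφ : AEMeasurable φ ν) :
    ∫⁻ x, φ x ∂ν = ∫⁻ s in Ioi (0 : ℝ), ν {x | ENNReal.ofReal s < φ x} := by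
  have hvol (c : ℝ≥0∞) : c = ∫⁻ s in Ioi (0 : ℝ),
      {s : ℝ | ENNReal.ofReal s < c}.indicator (fun _ => 1) s := by
    have hm : MeasurableSet {s : ℝ | ENNReal.ofReal s < c} :=
      measurableSet_lt ENNReal.measurable_ofReal measurable_const
    rw [lintegral_indicator hm, setLIntegral_const, one_mul,
      Measure.restrict_apply' measurableSet_Ioi]
    induction c with
    | top => simp
    | coe c =>
      have : {s : ℝ | ENNReal.ofReal s < c} ∩ Ioi 0 = Ioo 0 (c : ℝ) := by
        ext s
        simp only [mem_inter_iff, mem_ofPred_eq, mem_Ioi, mem_Ioo]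
        constructor
        · rintro ⟨h1, h2⟩
          exact ⟨h2, by simpa using (ENNReal.ofReal_lt_iff_lt_toReal h2.le ENNReal.coe_ne_top).1 h1⟩
        · rintro ⟨h1, h2⟩
          exact ⟨(ENNReal.ofReal_lt_iff_lt_toReal h1.le ENNReal.coe_ne_top).2 (by simpa using h2), h1⟩
      simp [this]
  have hmk := hφ.ae_eq_mk
  calc ∫⁻ x, φ x ∂ν = ∫⁻ x, hφ.mk φ x ∂ν := lintegral_congr_ae hmk
    _ = ∫⁻ x, (∫⁻ s in Ioi (0 : ℝ),
          {s : ℝ | ENNReal.ofReal s < hφ.mk φ x}.indicator (fun _ => 1) s) ∂ν :=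
        lintegral_congr fun x => hvol _
    _ = ∫⁻ s in Ioi (0 : ℝ), (∫⁻ x,
          {s : ℝ | ENNReal.ofReal s < hφ.mk φ x}.indicator (fun _ => 1) s ∂ν) := by
        refine lintegral_lintegral_swap (Measurable.aemeasurable ?_)
        have : MeasurableSet {q : α × ℝ | ENNReal.ofReal q.2 < hφ.mk φ q.1} :=
          measurableSet_lt (ENNReal.measurable_ofReal.comp measurable_snd)
            (hφ.measurable_mk.comp measurable_fst)
        exact (measurable_const.indicator this : Measurable
          ({q : α × ℝ | ENNReal.ofReal q.2 < hφ.mk φ q.1}.indicator fun _ => (1 : ℝ≥0∞)))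
    _ = ∫⁻ s in Ioi (0 : ℝ), ν {x | ENNReal.ofReal s < φ x} := by
        refine lintegral_congr fun s => ?_
        have h1 : (fun x => {s : ℝ | ENNReal.ofReal s < hφ.mk φ x}.indicator
            (fun _ => (1 : ℝ≥0∞)) s) = {x | ENNReal.ofReal s < hφ.mk φ x}.indicator fun _ => 1 := by
          ext x; simp [indicator]
        rw [h1, lintegral_indicator_const
          (measurableSet_lt measurable_const hφ.measurable_mk), one_mul]
        refine measure_congr (Filter.eventuallyEq_set.2 ?_)
        filter_upwards [hmk] with x hx
        rw [hx]

theorem volume_restrict_Ioi_ofReal_lt (c : ℝ≥0∞) :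
    volume.restrict (Ioi 0) {s : ℝ | ENNReal.ofReal s < c} = c := by
  have := lintegral_eq_lintegral_measure_lt (ν := Measure.dirac ()) (φ := fun _ => c)
    aemeasurable_const
  have hm : MeasurableSet {s : ℝ | ENNReal.ofReal s < c} :=
    measurableSet_lt ENNReal.measurable_ofReal measurable_const
  rw [← lintegral_indicator_one hm]
  simp only [lintegral_const, measure_univ, mul_one] at this
  refine Eq.trans (lintegral_congr fun s => ?_) this.symm
  by_cases hs : ENNReal.ofReal s < c <;> simp [hs]

/-- The part of `g^*` above a level `c` on `(0, t]` has at most the integral of the part of `g`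
above `c`, because `g^*` and `g` have the same distribution function. -/
theorem setLIntegral_rearr_tsub_le [SFinite μ] (hg : AEMeasurable g μ) (t : ℝ) (c : ℝ≥0∞) :
    ∫⁻ τ in Ioc 0 t, (rearr μ g τ - c) ≤ ∫⁻ x, (g x - c) ∂μ := by
  rw [lintegral_eq_lintegral_measure_lt (measurable_rearr.sub_const c).aemeasurable,
    lintegral_eq_lintegral_measure_lt (hg.sub_const c)]
  refine lintegral_mono fun s => ?_
  simp only [lt_tsub_iff_right, lt_rearr_iff]
  refine le_trans ?_ (volume_restrict_Ioi_ofReal_lt _).le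
  exact Measure.restrict_mono Ioc_subset_Ioi_self le_rfl _

/-- The reverse inequality, for a level `c ≥ g^*(t)`: then `g^*` exceeds `c` only on `(0, t]`. -/
theorem lintegral_tsub_le_setLIntegral_rearr [SFinite μ] (hg : AEMeasurable g μ) {t : ℝ}
    {c : ℝ≥0∞} (hc : rearr μ g t ≤ c) :
    ∫⁻ x, (g x - c) ∂μ ≤ ∫⁻ τ in Ioc 0 t, (rearr μ g τ - c) := by
  rw [lintegral_eq_lintegral_measure_lt (measurable_rearr.sub_const c).aemeasurable,
    lintegral_eq_lintegral_measure_lt (hg.sub_const c)]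
  refine lintegral_mono fun s => ?_
  simp only [lt_tsub_iff_right, lt_rearr_iff]
  refine (volume_restrict_Ioi_ofReal_lt _).ge.trans ?_
  have hD : μ {x | ENNReal.ofReal s + c < g x} ≤ ENNReal.ofReal t := by
    rw [← not_lt, ← lt_rearr_iff, not_lt]
    exact hc.trans le_add_self
  have hm : MeasurableSet {τ : ℝ | ENNReal.ofReal τ < μ {x | ENNReal.ofReal s + c < g x}} :=
    measurableSet_lt ENNReal.measurable_ofReal measurable_const
  rw [Measure.restrict_apply hm, Measure.restrict_apply hm]
  refine measure_mono fun τ hτ => ⟨hτ.1, hτ.2, ?_⟩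
  exact ((ENNReal.ofReal_lt_ofReal_iff_of_nonneg (le_of_lt hτ.2)).1
    (lt_of_lt_of_le hτ.1 hD)).le

/-- Countable subadditivity of `g ↦ ∫_0^t g^*`. By the previous two lemmas this integral is the
minimum over the levels `c` of `t c + ∫ (g - c)_+`, and the levels of the summands add up. -/
theorem setLIntegral_rearr_tsum_le [SFinite μ] {G : ℕ → Ω → ℝ≥0∞}
    (hG : ∀ k, AEMeasurable (G k) μ) (t : ℝ) :
    ∫⁻ τ in Ioc 0 t, rearr μ (fun x => ∑' k, G k x) τ ≤
      ∑' k, ∫⁻ τ in Ioc 0 t, rearr μ (G k) τ := by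
  set c : ℕ → ℝ≥0∞ := fun k => rearr μ (G k) t
  have hsub : ∀ x, (∑' k, G k x) - ∑' k, c k ≤ ∑' k, (G k x - c k) := fun x => by
    rw [tsub_le_iff_right, ← ENNReal.tsum_add]
    exact ENNReal.tsum_le_tsum fun k => le_tsub_add
  calc ∫⁻ τ in Ioc 0 t, rearr μ (fun x => ∑' k, G k x) τ
      ≤ ∫⁻ τ in Ioc 0 t, ((rearr μ (fun x => ∑' k, G k x) τ - ∑' k, c k) + ∑' k, c k) :=
        lintegral_mono fun τ => le_tsub_add
    _ = (∫⁻ τ in Ioc 0 t, (rearr μ (fun x => ∑' k, G k x) τ - ∑' k, c k)) +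
          ∫⁻ τ in Ioc 0 t, ∑' k, c k := lintegral_add_right _ measurable_const
    _ ≤ (∫⁻ x, ∑' k, (G k x - c k) ∂μ) + ∫⁻ τ in Ioc 0 t, ∑' k, c k := by
        gcongr
        exact (setLIntegral_rearr_tsub_le (AEMeasurable.tsum hG) t _).trans
          (lintegral_mono hsub)
    _ = ∑' k, ((∫⁻ x, (G k x - c k) ∂μ) + ∫⁻ τ in Ioc 0 t, c k) := by
        rw [lintegral_tsum fun k => (hG k).sub_const _, lintegral_tsum fun k => aemeasurable_const,
          ENNReal.tsum_add]
    _ ≤ ∑' k, ∫⁻ τ in Ioc 0 t, rearr μ (G k) τ := by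
        refine ENNReal.tsum_le_tsum fun k => ?_
        calc _ ≤ (∫⁻ τ in Ioc 0 t, (rearr μ (G k) τ - c k)) + ∫⁻ τ in Ioc 0 t, c k := by
              gcongr
              exact lintegral_tsub_le_setLIntegral_rearr (hG k) le_rfl
          _ = ∫⁻ τ in Ioc 0 t, ((rearr μ (G k) τ - c k) + c k) :=
              (lintegral_add_right _ measurable_const).symm
          _ = _ := setLIntegral_congr_fun measurableSet_Ioc fun τ hτ =>
              tsub_add_cancel_of_le (rearr_antitone hτ.2)

/-- Dilation: dividing the distribution function by a factor dilates the rearrangement. -/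
theorem rearr_eq_rearr_div {Ω' : Type*} [MeasurableSpace Ω'] {ν : Measure Ω'} {φ : Ω' → ℝ≥0∞}
    {a : ℝ} (ha : 0 < a) (h : ∀ s, μ {x | s < g x} = ENNReal.ofReal a * ν {x | s < φ x}) (t : ℝ) :
    rearr μ g t = rearr ν φ (t / a) := by
  unfold rearr
  congr 1
  ext s
  rw [mem_ofPred_eq, mem_ofPred_eq, h, ENNReal.ofReal_div_of_pos ha,
    ENNReal.le_div_iff_mul_le (by simp [ha]) (by simp), mul_comm]

end Rearrangement

/-! ### Triangle inequality and dilations for the Lorentz, Marcinkiewicz and `L_p` norms -/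

section Norms

variable {Ω : Type*} [MeasurableSpace Ω] {μ : Measure Ω} {g : Ω → ℝ≥0∞}
variable {Ω' : Type*} [MeasurableSpace Ω'] {ν : Measure Ω'} {φ : Ω' → ℝ≥0∞}
variable {p : ℝ}

theorem rootFun_apply (hp : 0 < p) (t : ℝ) : rootFun p hp t = max t 0 ^ (1 / p) := rfl

theorem rootFun_of_nonneg (hp : 0 < p) {t : ℝ} (ht : 0 ≤ t) : rootFun p hp t = t ^ (1 / p) := by
  rw [rootFun_apply, max_eq_left ht]

theorem rootFun_measure_eq_withDensity (hp : 0 < p) :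
    (rootFun p hp).measure = volume.withDensity
      ((Ioi 0).indicator fun s => ENNReal.ofReal (1 / p * s ^ (1 / p - 1))) := by
  refine Measure.ext_of_Ioc _ _ fun a b hab => ?_
  rw [StieltjesFunction.measure_Ioc, withDensity_apply _ measurableSet_Ioc,
    setLIntegral_indicator measurableSet_Ioi, inter_comm, Ioc_inter_Ioi, rootFun_apply,
    rootFun_apply]
  rcases le_or_gt b 0 with hb | hb
  · rw [max_eq_right hb, max_eq_right (hab.le.trans hb), Ioc_eq_empty (not_lt.2 hb)]
    simp
  have hab' : max a 0 ≤ b := max_le hab.le hb.le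
  have hexp : -1 < 1 / p - 1 := by have : 0 < 1 / p := by positivity
                                   linarith
  have hint : IntervalIntegrable (fun s : ℝ => 1 / p * s ^ (1 / p - 1)) volume (max a 0) b :=
    (intervalIntegral.intervalIntegrable_rpow' hexp).const_mul _
  rw [← ofReal_integral_eq_lintegral_ofReal
    ((intervalIntegrable_iff_integrableOn_Ioc_of_le hab').1 hint),
    ← intervalIntegral.integral_of_le hab', intervalIntegral.integral_const_mul,
    integral_rpow (Or.inl hexp), max_eq_left hb.le]
  · congr 1
    have : p ≠ 0 := hp.ne'
    simp only [sub_add_cancel]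
    field_simp
  · filter_upwards [ae_restrict_mem measurableSet_Ioc] with s hs
    have : 0 ≤ s := (le_max_right a 0).trans hs.1.le
    positivity

theorem ofReal_rpow_eq_setLIntegral_Ioi (hp : 1 < p) {s : ℝ} (hs : 0 < s) :
    ENNReal.ofReal (1 / p * s ^ (1 / p - 1)) =
      ∫⁻ τ in Ioi s, ENNReal.ofReal (1 / p * (1 - 1 / p) * τ ^ (1 / p - 2)) := by
  have hp1 : 1 / p < 1 := by rw [div_lt_one (by linarith)]; exact hp
  have hexp : 1 / p - 2 < -1 := by linarith
  have h0 : 0 < 1 / p := by positivity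
  rw [← ofReal_integral_eq_lintegral_ofReal ((integrableOn_Ioi_rpow_of_lt hexp hs).const_mul _),
    integral_const_mul, integral_Ioi_rpow_of_lt hexp hs]
  · congr 1
    rw [show 1 / p - 2 + 1 = 1 / p - 1 by ring]
    have : 1 / p - 1 ≠ 0 := by linarith
    rw [mul_assoc, mul_div_assoc']
    congr 1
    rw [eq_div_iff this]
    ring
  · filter_upwards [ae_restrict_mem measurableSet_Ioi] with τ hτ
    have : 0 < τ := hs.trans hτ
    have : 0 ≤ 1 - 1 / p := by linarith
    positivity

/-- Since `t ↦ t^{1/p}` is concave, its Stieltjes measure is a mixture of the Lebesgue measures on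
the intervals `(0, τ]`. -/
theorem setLIntegral_Ioi_rootFun (hp : 1 < p) {u : ℝ → ℝ≥0∞} (hu : Measurable u) :
    ∫⁻ s in Ioi 0, u s ∂(rootFun p (zero_lt_one.trans hp)).measure =
      ∫⁻ τ in Ioi 0, ENNReal.ofReal (1 / p * (1 - 1 / p) * τ ^ (1 / p - 2)) *
        ∫⁻ s in Ioc 0 τ, u s := by
  set w : ℝ → ℝ≥0∞ := fun τ => ENNReal.ofReal (1 / p * (1 - 1 / p) * τ ^ (1 / p - 2))
  have hw : Measurable w := by fun_prop
  have hd : Measurable fun s : ℝ => ENNReal.ofReal (1 / p * s ^ (1 / p - 1)) := by fun_prop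
  have hjoint : Measurable fun q : ℝ × ℝ => {q : ℝ × ℝ | q.1 < q.2}.indicator
      (fun q => w q.2 * u q.1) q :=
    ((hw.comp measurable_snd).mul (hu.comp measurable_fst)).indicator
      (measurableSet_lt measurable_fst measurable_snd)
  rw [rootFun_measure_eq_withDensity, restrict_withDensity measurableSet_Ioi,
    lintegral_withDensity_eq_lintegral_mul _ (hd.indicator measurableSet_Ioi) hu]
  calc _ = ∫⁻ s in Ioi 0, (∫⁻ τ in Ioi 0, {q : ℝ × ℝ | q.1 < q.2}.indicator
            (fun q => w q.2 * u q.1) (s, τ)) := by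
        refine setLIntegral_congr_fun measurableSet_Ioi fun s hs => ?_
        have hs' : (0 : ℝ) < s := hs
        rw [Pi.mul_apply, indicator_of_mem hs, ofReal_rpow_eq_setLIntegral_Ioi hp hs']
        have h1 : (fun τ => {q : ℝ × ℝ | q.1 < q.2}.indicator (fun q => w q.2 * u q.1) (s, τ)) =
            (Ioi s).indicator fun τ => w τ * u s := by
          ext τ; simp [indicator]
        rw [h1, setLIntegral_indicator measurableSet_Ioi, Ioi_inter_Ioi, sup_eq_left.2 hs'.le,
          lintegral_mul_const _ hw]
    _ = ∫⁻ τ in Ioi 0, (∫⁻ s in Ioi 0, {q : ℝ × ℝ | q.1 < q.2}.indicator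
            (fun q => w q.2 * u q.1) (s, τ)) := lintegral_lintegral_swap hjoint.aemeasurable
    _ = _ := by
        refine setLIntegral_congr_fun measurableSet_Ioi fun τ hτ => ?_
        have h1 : (fun s => {q : ℝ × ℝ | q.1 < q.2}.indicator (fun q => w q.2 * u q.1) (s, τ)) =
            (Iio τ).indicator fun s => w τ * u s := by
          ext s; simp [indicator]
        simp only [h1]
        rw [setLIntegral_indicator measurableSet_Iio, inter_comm, Ioi_inter_Iio,
          lintegral_const_mul _ hu, setLIntegral_congr Ioo_ae_eq_Ioc]

/-- On a probability space the rearrangement vanishes on `[1, ∞)`. -/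
theorem setLIntegral_Ioc_rearr_eq_Ioi [IsProbabilityMeasure μ] (m : Measure ℝ) {t : ℝ}
    (ht : 1 ≤ t) : ∫⁻ s in Ioc 0 t, rearr μ g s ∂m = ∫⁻ s in Ioi 0, rearr μ g s ∂m := by
  rw [← Ioc_union_Ioi_eq_Ioi (zero_le_one.trans ht),
    lintegral_union measurableSet_Ioi Ioc_disjoint_Ioi_same,
    setLIntegral_congr_fun (g := fun _ => 0) measurableSet_Ioi fun s hs =>
      rearr_eq_zero (ht.trans (le_of_lt hs))]
  simp

theorem lorentz_tsum_le [IsProbabilityMeasure μ] (hp : 1 < p) {G : ℕ → Ω → ℝ≥0∞}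
    (hG : ∀ k, AEMeasurable (G k) μ) :
    ∫⁻ s in Ioc 0 1, rearr μ (fun x => ∑' k, G k x) s
        ∂(rootFun p (zero_lt_one.trans hp)).measure ≤
      ∑' k, ∫⁻ s in Ioc 0 1, rearr μ (G k) s ∂(rootFun p (zero_lt_one.trans hp)).measure := by
  simp only [setLIntegral_Ioc_rearr_eq_Ioi _ le_rfl, setLIntegral_Ioi_rootFun hp measurable_rearr]
  have hF (k : ℕ) : Measurable fun τ : ℝ => ∫⁻ s in Ioc 0 τ, rearr μ (G k) s :=
    Monotone.measurable fun a b hab => lintegral_mono_set (Ioc_subset_Ioc_right hab)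
  have hw : Measurable fun τ : ℝ =>
      ENNReal.ofReal (1 / p * (1 - 1 / p) * τ ^ (1 / p - 2)) := by fun_prop
  have hwF (k : ℕ) : Measurable fun τ : ℝ => ENNReal.ofReal (1 / p * (1 - 1 / p) *
      τ ^ (1 / p - 2)) * ∫⁻ s in Ioc 0 τ, rearr μ (G k) s := hw.mul (hF k)
  rw [← lintegral_tsum fun k => (hwF k).aemeasurable]
  refine lintegral_mono fun τ => ?_
  rw [ENNReal.tsum_mul_left]
  gcongr
  exact setLIntegral_rearr_tsum_le hG τ

theorem marcinkiewicz_tsum_le [SFinite μ] (ψ : ℝ → ℝ) {G : ℕ → Ω → ℝ≥0∞}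
    (hG : ∀ k, AEMeasurable (G k) μ) :
    ⨆ t ∈ Ioc (0 : ℝ) 1, ENNReal.ofReal (ψ t / t) *
        ∫⁻ s in Ioc 0 t, rearr μ (fun x => ∑' k, G k x) s ≤
      ∑' k, ⨆ t ∈ Ioc (0 : ℝ) 1, ENNReal.ofReal (ψ t / t) * ∫⁻ s in Ioc 0 t, rearr μ (G k) s := by
  refine iSup₂_le fun t ht => ?_
  refine (mul_le_mul_right (setLIntegral_rearr_tsum_le hG t) _).trans ?_
  rw [← ENNReal.tsum_mul_left]
  exact ENNReal.tsum_le_tsum fun k => le_iSup₂ (f := fun t (_ : t ∈ Ioc (0 : ℝ) 1) =>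
    ENNReal.ofReal (ψ t / t) * ∫⁻ s in Ioc 0 t, rearr μ (G k) s) t ht

theorem eLpNorm_tsum_le (hp : 1 ≤ p) {G : ℕ → Ω → ℝ≥0∞} (hG : ∀ k, AEMeasurable (G k) μ) :
    eLpNorm (fun x => ∑' k, G k x) (ENNReal.ofReal p) μ ≤
      ∑' k, eLpNorm (G k) (ENNReal.ofReal p) μ := by
  have hp0 : 0 < p := zero_lt_one.trans_le hp
  have hfin (n : ℕ) : eLpNorm (∑ k ∈ Finset.range n, G k) (ENNReal.ofReal p) μ ≤
      ∑' k, eLpNorm (G k) (ENNReal.ofReal p) μ :=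
    (eLpNorm_sum_le (fun k _ => (hG k).aestronglyMeasurable)
      (by simpa using ENNReal.ofReal_le_ofReal hp)).trans (ENNReal.sum_le_tsum _)
  have hnorm (h : Ω → ℝ≥0∞) :
      eLpNorm h (ENNReal.ofReal p) μ = (∫⁻ x, h x ^ p ∂μ) ^ (1 / p) := by
    rw [eLpNorm_eq_lintegral_rpow_enorm_toReal (by simpa using hp0) (by simp),
      ENNReal.toReal_ofReal hp0.le]
    simp
  have hlim : Filter.Tendsto (fun n => ∫⁻ x, (∑ k ∈ Finset.range n, G k) x ^ p ∂μ) Filter.atTop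
      (nhds (∫⁻ x, (∑' k, G k x) ^ p ∂μ)) := by
    refine lintegral_tendsto_of_tendsto_of_monotone (fun n => ?_) ?_ ?_
    · exact (Finset.aemeasurable_sum _ fun k _ => hG k).pow_const p
    · refine Filter.Eventually.of_forall fun x m n hmn => ?_
      simp only [Finset.sum_apply]
      gcongr
    · refine Filter.Eventually.of_forall fun x => ?_
      simp only [Finset.sum_apply]
      exact (ENNReal.continuous_rpow_const.tendsto _).comp (ENNReal.tendsto_nat_tsum _)
  rw [hnorm]
  refine le_of_tendsto ((ENNReal.continuous_rpow_const.tendsto _).comp hlim)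
    (Filter.Eventually.of_forall fun n => ?_)
  rw [Function.comp_apply, ← hnorm]
  exact hfin n

/-- The image of the Stieltjes measure of `t ↦ t^{1/p}` under a dilation. -/
theorem map_div_rootFun_measure (hp : 0 < p) {a : ℝ} (ha : 0 < a) :
    (rootFun p hp).measure.map (· / a) =
      ENNReal.ofReal (a ^ (1 / p)) • (rootFun p hp).measure := by
  symm
  refine Measure.ext_of_Ioc' _ _ (fun x y _ => ?_) fun x y hxy => ?_
  · rw [Measure.smul_apply, StieltjesFunction.measure_Ioc]
    exact ENNReal.mul_ne_top ENNReal.ofReal_ne_top ENNReal.ofReal_ne_top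
  have hψ (z : ℝ) : rootFun p hp (z * a) = a ^ (1 / p) * rootFun p hp z := by
    rw [rootFun_apply, rootFun_apply, ← Real.mul_rpow ha.le (le_max_right _ _),
      mul_max_of_nonneg _ _ ha.le, mul_zero, mul_comm a]
  rw [Measure.map_apply (by fun_prop) measurableSet_Ioc, Measure.smul_apply,
    StieltjesFunction.measure_Ioc, smul_eq_mul, ← ENNReal.ofReal_mul (by positivity),
    show (fun z => z / a) ⁻¹' Ioc x y = Ioc (x * a) (y * a) by
      ext z; simp [lt_div_iff₀ ha, div_le_iff₀ ha],
    StieltjesFunction.measure_Ioc, hψ, hψ, mul_sub]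

theorem lorentz_dilation [IsProbabilityMeasure μ] [IsProbabilityMeasure ν] (hp : 0 < p) {a : ℝ}
    (ha : 0 < a) (h : ∀ s, μ {x | s < g x} = ENNReal.ofReal a * ν {x | s < φ x}) :
    ∫⁻ s in Ioc 0 1, rearr μ g s ∂(rootFun p hp).measure =
      ENNReal.ofReal (a ^ (1 / p)) * ∫⁻ s in Ioc 0 1, rearr ν φ s ∂(rootFun p hp).measure := by
  rw [setLIntegral_Ioc_rearr_eq_Ioi _ le_rfl, setLIntegral_Ioc_rearr_eq_Ioi _ le_rfl]
  have hpre : Ioi (0 : ℝ) = (· / a) ⁻¹' Ioi 0 := by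
    ext z; simp [div_pos_iff_of_pos_right ha]
  simp only [rearr_eq_rearr_div ha h]
  conv_lhs => rw [hpre]
  rw [← setLIntegral_map measurableSet_Ioi measurable_rearr (by fun_prop),
    map_div_rootFun_measure hp ha, Measure.restrict_smul, lintegral_smul_measure, smul_eq_mul]

theorem setLIntegral_rearr_dilation {a : ℝ} (ha : 0 < a)
    (h : ∀ s, μ {x | s < g x} = ENNReal.ofReal a * ν {x | s < φ x}) (t : ℝ) :
    ∫⁻ s in Ioc 0 t, rearr μ g s = ENNReal.ofReal a * ∫⁻ s in Ioc 0 (t / a), rearr ν φ s := by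
  have hpre : Ioc (0 : ℝ) t = (a⁻¹ * ·) ⁻¹' Ioc 0 (t / a) := by
    ext z
    rw [mem_preimage, inv_mul_eq_div, mem_Ioc, mem_Ioc, div_pos_iff_of_pos_right ha,
      div_le_div_iff_of_pos_right ha]
  simp only [rearr_eq_rearr_div ha h, div_eq_inv_mul _ a] at hpre ⊢
  rw [hpre, ← setLIntegral_map measurableSet_Ioc measurable_rearr (by fun_prop),
    Real.map_volume_mul_left (inv_pos.2 ha).ne', Measure.restrict_smul, lintegral_smul_measure,
    smul_eq_mul, inv_inv, abs_of_pos ha]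

theorem marcinkiewicz_dilation_le [IsProbabilityMeasure ν] (hp : 1 < p)
    {a : ℝ} (ha : 0 < a) (h : ∀ s, μ {x | s < g x} = ENNReal.ofReal a * ν {x | s < φ x}) :
    ⨆ t ∈ Ioc (0 : ℝ) 1, ENNReal.ofReal (rootFun p (zero_lt_one.trans hp) t / t) *
        ∫⁻ s in Ioc 0 t, rearr μ g s ≤
      ENNReal.ofReal (a ^ (1 / p)) *
        ⨆ t ∈ Ioc (0 : ℝ) 1, ENNReal.ofReal (rootFun p (zero_lt_one.trans hp) t / t) *
          ∫⁻ s in Ioc 0 t, rearr ν φ s := by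
  have hp0 := zero_lt_one.trans hp
  have hexp : 1 / p - 1 ≤ 0 := by
    rw [sub_nonpos, div_le_one hp0]; exact hp.le
  have hψ {t : ℝ} (ht : 0 < t) : rootFun p hp0 t / t = t ^ (1 / p - 1) := by
    rw [rootFun_of_nonneg hp0 ht.le, Real.rpow_sub_one ht.ne']
  refine iSup₂_le fun t ht => ?_
  -- For `t > a` the integral over `(0, t / a]` is the integral over `(0, 1]`.
  set r := min (t / a) 1
  have hr0 : 0 < r := lt_min (div_pos ht.1 ha) one_pos
  have hr : r ∈ Ioc (0 : ℝ) 1 := ⟨hr0, min_le_right _ _⟩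
  have hint : ∫⁻ s in Ioc 0 (t / a), rearr ν φ s = ∫⁻ s in Ioc 0 r, rearr ν φ s := by
    rcases le_total (t / a) 1 with h1 | h1
    · rw [show r = t / a from min_eq_left h1]
    · rw [show r = 1 from min_eq_right h1, setLIntegral_Ioc_rearr_eq_Ioi _ h1,
        setLIntegral_Ioc_rearr_eq_Ioi _ le_rfl]
  rw [setLIntegral_rearr_dilation ha h, hint, ← mul_assoc,
    ← ENNReal.ofReal_mul (by rw [hψ ht.1]; exact Real.rpow_nonneg ht.1.le _)]
  calc _ ≤ ENNReal.ofReal (a ^ (1 / p) * (rootFun p hp0 r / r)) *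
        ∫⁻ s in Ioc 0 r, rearr ν φ s := by
        gcongr ENNReal.ofReal ?_ * _
        have hle : t ^ (1 / p - 1) ≤ (a * r) ^ (1 / p - 1) := by
          refine Real.rpow_le_rpow_of_nonpos (by positivity) ?_ hexp
          calc a * r ≤ a * (t / a) := by gcongr; exact min_le_left _ _
            _ = t := mul_div_cancel₀ t ha.ne'
        rw [hψ ht.1, hψ hr0]
        calc t ^ (1 / p - 1) * a ≤ (a * r) ^ (1 / p - 1) * a := by gcongr
          _ = _ := by
            rw [Real.mul_rpow ha.le hr0.le, Real.rpow_sub_one ha.ne']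
            field_simp
    _ = ENNReal.ofReal (a ^ (1 / p)) * (ENNReal.ofReal (rootFun p hp0 r / r) *
        ∫⁻ s in Ioc 0 r, rearr ν φ s) := by
        rw [ENNReal.ofReal_mul (by positivity), mul_assoc]
    _ ≤ _ := by
        gcongr
        exact le_iSup₂ (f := fun t (_ : t ∈ Ioc (0 : ℝ) 1) =>
          ENNReal.ofReal (rootFun p hp0 t / t) * ∫⁻ s in Ioc 0 t, rearr ν φ s) r hr

theorem eLpNorm_dilation [SFinite μ] [SFinite ν] (hp : 0 < p) {a : ℝ} (ha : 0 < a)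
    (hg : AEMeasurable g μ) (hφ : AEMeasurable φ ν)
    (h : ∀ s, μ {x | s < g x} = ENNReal.ofReal a * ν {x | s < φ x}) :
    eLpNorm g (ENNReal.ofReal p) μ =
      ENNReal.ofReal (a ^ (1 / p)) * eLpNorm φ (ENNReal.ofReal p) ν := by
  rw [eLpNorm_eq_lintegral_rpow_enorm_toReal (by simpa using hp) (by simp),
    eLpNorm_eq_lintegral_rpow_enorm_toReal (by simpa using hp) (by simp),
    ENNReal.toReal_ofReal hp.le, ← ENNReal.ofReal_rpow_of_nonneg ha.le (by positivity),
    ← ENNReal.mul_rpow_of_nonneg _ _ (by positivity)]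
  congr 1
  simp only [enorm_eq_self]
  rw [lintegral_eq_lintegral_measure_lt (hg.pow_const p),
    lintegral_eq_lintegral_measure_lt (hφ.pow_const p),
    ← lintegral_const_mul' _ _ ENNReal.ofReal_ne_top]
  simp only [← ENNReal.rpow_inv_lt_iff hp, h]

end Norms

/-! ### The Kruglov operator -/

section Kruglov

variable {B : ℕ → Set unitInterval} {f : unitInterval → ℝ}

instance : IsProbabilityMeasure cubeMeasure := by
  unfold cubeMeasure; infer_instance

theorem kruglov_of_mem (hB : IsPoissonSets B) (f : unitInterval → ℝ) {n : ℕ} (hn : 1 ≤ n)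
    {ω : ℕ → unitInterval} (hω : ω 0 ∈ B n) :
    kruglov B f ω = ∑ k ∈ Finset.Icc 1 n, f (ω k) := by
  unfold kruglov
  rw [tsum_eq_single n]
  · simp [hω]
  · intro m hm
    rcases Nat.eq_zero_or_pos m with rfl | hm0
    · simp
    · have : ω 0 ∉ B m := fun h => disjoint_left.1 (hB.disjoint m n hm0 hn hm) h hω
      simp [this]

theorem kruglov_of_notMem {ω : ℕ → unitInterval} (hω : ∀ n, 1 ≤ n → ω 0 ∉ B n) :
    kruglov B f ω = 0 := by
  unfold kruglov
  refine (tsum_congr fun n => Finset.sum_eq_zero fun k hk => ?_).trans tsum_zero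
  simp [hω n ((Finset.mem_Icc.1 hk).1.trans (Finset.mem_Icc.1 hk).2)]

theorem measurePreserving_eval_cubeMeasure (k : ℕ) :
    MeasurePreserving (fun ω : ℕ → unitInterval => ω k) cubeMeasure volume :=
  measurePreserving_eval_infinitePi _ k

/-- The coordinates `ω_0` and `ω_k` are independent. -/
theorem measurePreserving_eval_prod {k : ℕ} (hk : k ≠ 0) :
    MeasurePreserving (fun ω : ℕ → unitInterval => (ω 0, ω k)) cubeMeasure
      (volume.prod volume) := by
  refine ⟨by fun_prop, ?_⟩
  have hind : ProbabilityTheory.IndepFun (fun ω : ℕ → unitInterval => ω 0) (fun ω => ω k)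
      cubeMeasure :=
    (ProbabilityTheory.iIndepFun_infinitePi (P := fun _ : ℕ => (volume : Measure unitInterval))
      (X := fun _ ω => ω) (fun _ => measurable_id)).indepFun hk.symm
  rw [(ProbabilityTheory.indepFun_iff_map_prod_eq_prod_map_map
      (measurable_pi_apply 0).aemeasurable (measurable_pi_apply k).aemeasurable).1 hind,
    (measurePreserving_eval_cubeMeasure 0).map_eq, (measurePreserving_eval_cubeMeasure k).map_eq]

theorem aemeasurable_comp_eval (hf : AEMeasurable f) (k : ℕ) :
    AEMeasurable (fun ω : ℕ → unitInterval => f (ω k)) cubeMeasure :=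
  hf.comp_quasiMeasurePreserving (measurePreserving_eval_cubeMeasure k).quasiMeasurePreserving

theorem aemeasurable_kruglov (hB : IsPoissonSets B) (hf : AEMeasurable f) :
    AEMeasurable (kruglov B f) cubeMeasure := by
  unfold kruglov
  refine AEMeasurable.tsum fun n => Finset.aemeasurable_fun_sum _ fun k hk => ?_
  have hn : 1 ≤ n := (Finset.mem_Icc.1 hk).1.trans (Finset.mem_Icc.1 hk).2
  exact (aemeasurable_comp_eval hf k).mul
    ((measurable_const.indicator (hB.measurableSet n hn)).comp (measurable_pi_apply 0)).aemeasurable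

/-- The event `{N ≥ k}`, where `N` is the Poisson variable with `N = n` on `B n`. -/
def tailSet (B : ℕ → Set unitInterval) (k : ℕ) : Set unitInterval := ⋃ n, B (k + n)

theorem measurableSet_tailSet (hB : IsPoissonSets B) {k : ℕ} (hk : 1 ≤ k) :
    MeasurableSet (tailSet B k) :=
  MeasurableSet.iUnion fun n => hB.measurableSet _ (by omega)

theorem volume_tailSet_le (hB : IsPoissonSets B) {k : ℕ} (hk : 1 ≤ k) :
    volume (tailSet B k) ≤ ENNReal.ofReal (1 / (k.factorial : ℝ)) := by
  have hsum : HasSum (fun n : ℕ => 1 / (Real.exp 1 * k.factorial) * (1 / (n.factorial : ℝ)))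
      (1 / (k.factorial : ℝ)) := by
    have h := (NormedSpace.expSeries_div_hasSum_exp (1 : ℝ)).mul_left
      (1 / (Real.exp 1 * k.factorial))
    have he : 1 / (Real.exp 1 * (k.factorial : ℝ)) * Real.exp 1 = 1 / k.factorial := by
      field_simp
    rw [← Real.exp_eq_exp_ℝ, he] at h
    simpa only [one_pow] using h
  calc volume (tailSet B k) ≤ ∑' n, volume (B (k + n)) := measure_iUnion_le _
    _ ≤ ∑' n : ℕ, ENNReal.ofReal (1 / (Real.exp 1 * k.factorial) * (1 / (n.factorial : ℝ))) := by
        refine ENNReal.tsum_le_tsum fun n => ?_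
        rw [hB.volume_eq _ (by omega)]
        refine ENNReal.ofReal_le_ofReal ?_
        have hle : (k.factorial : ℝ) * n.factorial ≤ (k + n).factorial := by
          exact_mod_cast Nat.le_of_dvd (Nat.factorial_pos _)
            (Nat.factorial_mul_factorial_dvd_factorial_add k n)
        rw [div_mul_div_comm, one_mul, mul_assoc]
        gcongr
    _ = _ := by
        rw [← ENNReal.ofReal_tsum_of_nonneg (fun n => by positivity) hsum.summable, hsum.tsum_eq]

theorem volume_tailSet_pos (hB : IsPoissonSets B) {k : ℕ} (hk : 1 ≤ k) :
    0 < (volume (tailSet B k)).toReal := by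
  refine ENNReal.toReal_pos (ne_of_gt ?_) (measure_ne_top _ _)
  have hpos : 0 < volume (B k) := by
    rw [hB.volume_eq k hk]
    have := Real.exp_pos 1
    exact ENNReal.ofReal_pos.2 (by positivity)
  exact hpos.trans_le (measure_mono (subset_iUnion_of_subset 0 (by simp)))

/-- The `k`-th summand `χ_{N ≥ k} |f(ω_k)|` of the bound for `|K f|`. -/
noncomputable def kruglovTerm (B : ℕ → Set unitInterval) (f : unitInterval → ℝ) (k : ℕ)
    (ω : ℕ → unitInterval) : ℝ≥0∞ :=
  {ω : ℕ → unitInterval | ω 0 ∈ tailSet B k}.indicator (fun ω => ‖f (ω k)‖ₑ) ω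

theorem enorm_kruglov_le (hB : IsPoissonSets B) (f : unitInterval → ℝ) (ω : ℕ → unitInterval) :
    ‖kruglov B f ω‖ₑ ≤ ∑' k, kruglovTerm B f (k + 1) ω := by
  by_cases h : ∃ n, 1 ≤ n ∧ ω 0 ∈ B n
  · obtain ⟨n, hn, hω⟩ := h
    rw [kruglov_of_mem hB f hn hω]
    calc _ ≤ ∑ k ∈ Finset.Icc 1 n, ‖f (ω k)‖ₑ := enorm_sum_le _ _
      _ = ∑ k ∈ Finset.range n, kruglovTerm B f (k + 1) ω := by
          rw [Finset.range_eq_Ico, Finset.sum_Ico_add' (fun k => kruglovTerm B f k ω) 0 n 1]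
          refine Finset.sum_congr rfl fun k hk => ?_
          have hk' := Finset.mem_Ico.1 hk
          have hmem : ω 0 ∈ tailSet B k :=
            mem_iUnion.2 ⟨n - k, by rwa [Nat.add_sub_cancel' (by omega)]⟩
          simp [kruglovTerm, hmem]
      _ ≤ _ := ENNReal.sum_le_tsum _
  · push Not at h
    simp [kruglov_of_notMem h]

theorem aemeasurable_kruglovTerm (hB : IsPoissonSets B) (hf : AEMeasurable f) {k : ℕ}
    (hk : 1 ≤ k) : AEMeasurable (kruglovTerm B f k) cubeMeasure :=
  (aemeasurable_comp_eval hf k).enorm.indicator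
    (measurable_pi_apply 0 (measurableSet_tailSet hB hk))

/-- By independence, the distribution function of the `k`-th summand is that of `f` times the
probability of `{N ≥ k}`. -/
theorem cubeMeasure_lt_kruglovTerm (hB : IsPoissonSets B) (hf : AEMeasurable f) {k : ℕ}
    (hk : 1 ≤ k) (s : ℝ≥0∞) :
    cubeMeasure {ω | s < kruglovTerm B f k ω} =
      ENNReal.ofReal (volume (tailSet B k)).toReal * volume {x | s < ‖f x‖ₑ} := by
  have hset : {ω | s < kruglovTerm B f k ω} =
      (fun ω : ℕ → unitInterval => (ω 0, ω k)) ⁻¹' (tailSet B k ×ˢ {x | s < ‖f x‖ₑ}) := by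
    ext ω
    by_cases h : ω 0 ∈ tailSet B k <;> simp [kruglovTerm, h]
  have hnull : NullMeasurableSet (tailSet B k ×ˢ {x | s < ‖f x‖ₑ})
      ((volume : Measure unitInterval).prod volume) :=
    (measurableSet_tailSet hB hk).nullMeasurableSet.prod
      (nullMeasurableSet_lt aemeasurable_const hf.enorm)
  rw [hset, (measurePreserving_eval_prod (by omega)).measure_preimage hnull, Measure.prod_prod,
    ENNReal.ofReal_toReal (measure_ne_top _ _)]

/-- If the norm satisfies the countable triangle inequality and scales by `a^{1/p}` when the
distribution function is multiplied by `a`, then the operator norm of `K` is at most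
`∑_k P(N ≥ k)^{1/p}`. -/
theorem kruglovNorm_le_tsum (hB : IsPoissonSets B) {p : ℝ}
    {NX : (unitInterval → ℝ≥0∞) → ℝ≥0∞} {NY : ((ℕ → unitInterval) → ℝ≥0∞) → ℝ≥0∞}
    (hmono : ∀ g h, g ≤ h → NY g ≤ NY h)
    (htsum : ∀ G : ℕ → (ℕ → unitInterval) → ℝ≥0∞, (∀ k, AEMeasurable (G k) cubeMeasure) →
      NY (fun ω => ∑' k, G k ω) ≤ ∑' k, NY (G k))
    (hdil : ∀ (a : ℝ) (g : (ℕ → unitInterval) → ℝ≥0∞) (φ : unitInterval → ℝ≥0∞), 0 < a →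
      AEMeasurable g cubeMeasure → AEMeasurable φ →
      (∀ s, cubeMeasure {ω | s < g ω} = ENNReal.ofReal a * volume {x | s < φ x}) →
      NY g ≤ ENNReal.ofReal (a ^ (1 / p)) * NX φ) :
    kruglovNorm B (fun f => NX fun x => ‖f x‖ₑ) (fun f => NY fun ω => ‖f ω‖ₑ) ≤
      ∑' k : ℕ, ENNReal.ofReal ((volume (tailSet B (k + 1))).toReal ^ (1 / p)) := by
  refine sInf_le fun f hf _ => ⟨aemeasurable_kruglov hB hf, ?_⟩
  calc NY (fun ω => ‖kruglov B f ω‖ₑ) ≤ NY fun ω => ∑' k, kruglovTerm B f (k + 1) ω :=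
        hmono _ _ (enorm_kruglov_le hB f)
    _ ≤ ∑' k, NY (kruglovTerm B f (k + 1)) :=
        htsum _ fun k => aemeasurable_kruglovTerm hB hf (by omega)
    _ ≤ ∑' k : ℕ, ENNReal.ofReal ((volume (tailSet B (k + 1))).toReal ^ (1 / p)) *
          NX fun x => ‖f x‖ₑ :=
        ENNReal.tsum_le_tsum fun k => hdil _ _ _ (volume_tailSet_pos hB (by omega))
          (aemeasurable_kruglovTerm hB hf (by omega)) hf.enorm
          (cubeMeasure_lt_kruglovTerm hB hf (by omega))
    _ = _ := ENNReal.tsum_mul_right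

/-- Lower bound, tested on `f = 1`: if the norm of `1` is at most `1`, and every function that is
at least `n` on a set of measure `b` has norm at least `n (b / 2)^{1/p}`, then so has `K`. -/
theorem le_kruglovNorm (hB : IsPoissonSets B) {p : ℝ} {n : ℕ} (hn : 1 ≤ n)
    {NX : (unitInterval → ℝ) → ℝ≥0∞} {NY : ((ℕ → unitInterval) → ℝ) → ℝ≥0∞}
    (hone : NX (fun _ => 1) ≤ 1)
    (hlow : ∀ (b : ℝ) (S : Set (ℕ → unitInterval)) (g : (ℕ → unitInterval) → ℝ), 0 < b → b ≤ 1 →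
      MeasurableSet S → cubeMeasure S = ENNReal.ofReal b → (∀ ω ∈ S, (n : ℝ≥0∞) ≤ ‖g ω‖ₑ) →
      (n : ℝ≥0∞) * ENNReal.ofReal ((b / 2) ^ (1 / p)) ≤ NY g) :
    (n : ℝ≥0∞) * ENNReal.ofReal ((1 / (Real.exp 1 * (n.factorial : ℝ)) / 2) ^ (1 / p)) ≤
      kruglovNorm B NX NY := by
  refine le_sInf fun C hC => ?_
  have h1 := (hC (fun _ => 1) aemeasurable_const (hone.trans_lt ENNReal.one_lt_top)).2
  refine le_trans ?_ (h1.trans ((mul_le_mul_right hone C).trans (mul_one C).le))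
  have he : 1 ≤ Real.exp 1 := Real.one_le_exp zero_le_one
  have hfac : (1 : ℝ) ≤ n.factorial := by exact_mod_cast n.factorial_pos
  refine hlow _ ((fun ω => ω 0) ⁻¹' B n) _ (by positivity) ?_
    (measurable_pi_apply 0 (hB.measurableSet n hn)) ?_ ?_
  · rw [div_le_one (by positivity)]
    exact one_le_mul_of_one_le_of_one_le he hfac
  · rw [(measurePreserving_eval_cubeMeasure 0).measure_preimage
      (hB.measurableSet n hn).nullMeasurableSet, hB.volume_eq n hn]
  · intro ω hω
    rw [kruglov_of_mem hB _ hn hω]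
    simp

end Kruglov

/-! ### The order `p / ln (p + 1)` -/

section Asymptotics

variable {p : ℝ}

/-- The upper estimate comes from `1 / k! ≤ e^x x^{-k}` with `x = (p + 1)^{1/2}`: since `x / p` is
bounded, the `p`-th roots are dominated by a geometric series of ratio `x^{-1/p}`. -/
theorem tsum_ofReal_rpow_le (hp : 1 < p) {a : ℕ → ℝ} (ha : ∀ k, 0 ≤ a k)
    (hle : ∀ k, a k ≤ 1 / ((k + 1).factorial : ℝ)) :
    ∑' k : ℕ, ENNReal.ofReal (a k ^ (1 / p)) ≤
      ENNReal.ofReal (2 * Real.exp 2 * (p / Real.log (p + 1))) := by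
  have hp0 : 0 < p := by linarith
  have hlog : 0 < Real.log (p + 1) := Real.log_pos (by linarith)
  set x := Real.sqrt (p + 1)
  have hx : 1 < x := Real.lt_sqrt_of_sq_lt (by linarith)
  have hx0 : 0 < x := by linarith
  have hxp : x / p ≤ 2 := by
    rw [div_le_iff₀ hp0]
    exact Real.sqrt_le_iff.2 ⟨by linarith, by nlinarith⟩
  set y := x ^ (1 / p)
  have hy1 : Real.log (p + 1) / (2 * p) ≤ y - 1 := by
    have h1 := Real.add_one_le_exp (Real.log x * (1 / p))
    rw [← Real.rpow_def_of_pos hx0, Real.log_sqrt (by linarith)] at h1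
    have h2 : Real.log (p + 1) / 2 * (1 / p) = Real.log (p + 1) / (2 * p) := by field_simp
    linarith
  have hy : 1 < y := by
    have : 0 < Real.log (p + 1) / (2 * p) := by positivity
    linarith
  have hy0 : 0 < y := by linarith
  have hterm (k : ℕ) : a k ^ (1 / p) ≤ Real.exp 2 * y⁻¹ * y⁻¹ ^ k := by
    have h1 : a k ≤ Real.exp x * (x ^ (k + 1))⁻¹ := by
      refine (hle k).trans ?_
      have h2 := Real.pow_div_factorial_le_exp x hx0.le (k + 1)
      rw [← div_eq_mul_inv, le_div_iff₀ (by positivity)]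
      rwa [div_mul_eq_mul_div, one_mul]
    calc a k ^ (1 / p) ≤ (Real.exp x * (x ^ (k + 1))⁻¹) ^ (1 / p) :=
          Real.rpow_le_rpow (ha k) h1 (by positivity)
      _ = Real.exp (x / p) * y⁻¹ ^ (k + 1) := by
          rw [Real.mul_rpow (by positivity) (by positivity), ← Real.exp_mul, mul_one_div,
            Real.inv_rpow (by positivity), ← Real.rpow_natCast, ← Real.rpow_mul hx0.le,
            mul_comm _ (1 / p), Real.rpow_mul hx0.le, Real.rpow_natCast, inv_pow]
      _ ≤ Real.exp 2 * y⁻¹ ^ (k + 1) := by gcongr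
      _ = _ := by rw [pow_succ']; ring
  have hgeom : HasSum (fun k : ℕ => Real.exp 2 * y⁻¹ * y⁻¹ ^ k)
      (Real.exp 2 * y⁻¹ * (1 - y⁻¹)⁻¹) :=
    (hasSum_geometric_of_lt_one (by positivity) (inv_lt_one_of_one_lt₀ hy)).mul_left _
  calc _ ≤ ∑' k : ℕ, ENNReal.ofReal (Real.exp 2 * y⁻¹ * y⁻¹ ^ k) :=
        ENNReal.tsum_le_tsum fun k => ENNReal.ofReal_le_ofReal (hterm k)
    _ = ENNReal.ofReal (Real.exp 2 * y⁻¹ * (1 - y⁻¹)⁻¹) := by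
        rw [← ENNReal.ofReal_tsum_of_nonneg (fun k => by positivity) hgeom.summable,
          hgeom.tsum_eq]
    _ ≤ _ := by
        refine ENNReal.ofReal_le_ofReal ?_
        have h1 : Real.exp 2 * y⁻¹ * (1 - y⁻¹)⁻¹ = Real.exp 2 / (y - 1) := by
          have : y - 1 ≠ 0 := by linarith
          have h2 : 1 - y⁻¹ = (y - 1) / y := by field_simp
          rw [h2]
          field_simp
        rw [h1]
        calc Real.exp 2 / (y - 1) ≤ Real.exp 2 / (Real.log (p + 1) / (2 * p)) := by gcongr
          _ = _ := by field_simp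

/-- The lower estimate: for `n ≈ p / ln (p + 1)` the number `(n!)^{1/p}` is bounded, because
`n ln n = O(p)`. -/
theorem exists_le_natCast_mul_rpow (hp : 1 < p) : ∃ n : ℕ, 1 ≤ n ∧
    Real.exp (-4) / (2 * Real.exp 1) * (p / Real.log (p + 1)) ≤
      n * (1 / (Real.exp 1 * (n.factorial : ℝ)) / 2) ^ (1 / p) := by
  have hp0 : 0 < p := by linarith
  have hlog : 0 < Real.log (p + 1) := Real.log_pos (by linarith)
  set r := p / Real.log (p + 1) with hr
  have hr1 : 1 ≤ r := by
    rw [hr, one_le_div hlog]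
    have := Real.log_le_sub_one_of_pos (show 0 < p + 1 by linarith)
    linarith
  have hr2 : r ≤ 2 * p := by
    have h2 : Real.log 2 ≤ Real.log (p + 1) := Real.log_le_log (by norm_num) (by linarith)
    have := Real.log_two_gt_d9
    rw [hr, div_le_iff₀ hlog]
    nlinarith
  have hn1 : r ≤ ⌈r⌉₊ := Nat.le_ceil r
  have hn2 : (⌈r⌉₊ : ℝ) < r + 1 := Nat.ceil_lt_add_one (by linarith)
  have hnpos : 1 ≤ ⌈r⌉₊ := by exact_mod_cast hr1.trans hn1
  refine ⟨⌈r⌉₊, hnpos, ?_⟩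
  generalize ⌈r⌉₊ = n at *
  have hn0 : (0 : ℝ) < n := by linarith
  have hlogn : Real.log n ≤ 2 * Real.log (p + 1) := by
    calc Real.log n ≤ Real.log ((p + 1) ^ 2) := Real.log_le_log hn0 (by nlinarith)
      _ = _ := by simp
  have hlogn0 : 0 ≤ Real.log n := Real.log_nonneg (by linarith)
  have hnlog : n * Real.log n ≤ 4 * p := by
    calc n * Real.log n ≤ (2 * r) * (2 * Real.log (p + 1)) := by
          gcongr
          linarith
      _ = 4 * p := by rw [hr]; field_simp; ring
  have hp1 : 1 / p ≤ 1 := by rw [div_le_one hp0]; exact hp.le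
  have he : 0 < Real.exp 1 := Real.exp_pos 1
  have he1 : 1 ≤ Real.exp 1 := Real.one_le_exp zero_le_one
  have hfac : Real.exp (-4) ≤ (1 / (n.factorial : ℝ)) ^ (1 / p) := by
    have h1 : (n.factorial : ℝ) ≤ Real.exp (4 * p) := by
      calc (n.factorial : ℝ) ≤ (n : ℝ) ^ n := by exact_mod_cast Nat.factorial_le_pow n
        _ = Real.exp (n * Real.log n) := by
            rw [Real.exp_nat_mul, Real.exp_log hn0]
        _ ≤ _ := Real.exp_le_exp.2 hnlog
    have h2 : Real.exp (-4) = (1 / Real.exp (4 * p)) ^ (1 / p) := by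
      rw [one_div, ← Real.exp_neg, ← Real.exp_mul]
      congr 1
      field_simp
    rw [h2]
    have : (0 : ℝ) < n.factorial := by exact_mod_cast n.factorial_pos
    gcongr
  have hconst : 1 / (2 * Real.exp 1) ≤ (1 / (2 * Real.exp 1)) ^ (1 / p) := by
    refine Real.self_le_rpow_of_le_one (by positivity) ?_ hp1
    rw [div_le_one (by positivity)]
    linarith
  have hsplit : (1 / (Real.exp 1 * (n.factorial : ℝ)) / 2) ^ (1 / p) =
      (1 / (2 * Real.exp 1)) ^ (1 / p) * (1 / (n.factorial : ℝ)) ^ (1 / p) := by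
    rw [← Real.mul_rpow (by positivity) (by positivity)]
    congr 1
    field_simp
  rw [hsplit]
  calc _ = r * (1 / (2 * Real.exp 1) * Real.exp (-4)) := by ring
    _ ≤ _ := by gcongr

end Asymptotics

/-! ### Bounds for the three norms -/

section Bounds

variable {Ω : Type*} [MeasurableSpace Ω] {μ : Measure Ω} {p : ℝ}

theorem le_rearr {g : Ω → ℝ≥0∞} {S : Set Ω} {c : ℝ≥0∞} {t : ℝ} (hS : ∀ x ∈ S, c ≤ g x)
    (ht : ENNReal.ofReal t < μ S) : c ≤ rearr μ g t :=
  le_of_forall_lt fun _ hs => lt_rearr_iff.2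
    (ht.trans_le (measure_mono fun x hx => hs.trans_le (hS x hx)))

/-- Integrating only up to `b / 2` keeps the bound of `le_rearr` away from the endpoint `b`; after
taking `p`-th roots this costs at most a factor `2`. -/
theorem setLIntegral_rearr_ge {g : Ω → ℝ≥0∞} {S : Set Ω} {c : ℝ≥0∞} {b : ℝ} (hb : 0 < b)
    (hS : ∀ x ∈ S, c ≤ g x) (hμ : μ S = ENNReal.ofReal b) (m : Measure ℝ) :
    c * m (Ioc 0 (b / 2)) ≤ ∫⁻ s in Ioc 0 (b / 2), rearr μ g s ∂m := by
  rw [← setLIntegral_const]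
  refine setLIntegral_mono measurable_rearr fun s hs => le_rearr hS ?_
  rw [hμ]
  exact (ENNReal.ofReal_lt_ofReal_iff hb).2 (hs.2.trans_lt (half_lt_self hb))

theorem rearr_one_le (t : ℝ) : rearr μ (fun _ => ‖(1 : ℝ)‖ₑ) t ≤ 1 :=
  sInf_le (by simp)

theorem kruglovNormLp_le {B : ℕ → Set unitInterval} (hB : IsPoissonSets B) (hp : 1 < p) :
    kruglovNormLp B p ≤
      ∑' k : ℕ, ENNReal.ofReal ((volume (tailSet B (k + 1))).toReal ^ (1 / p)) := by
  have h := kruglovNorm_le_tsum hB (p := p)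
    (NX := fun g => eLpNorm g (ENNReal.ofReal p) volume)
    (NY := fun g => eLpNorm g (ENNReal.ofReal p) cubeMeasure)
    (fun g h hgh => eLpNorm_mono_enorm fun x => hgh x)
    (fun G hG => eLpNorm_tsum_le hp.le hG)
    (fun a g φ ha hg hφ h => (eLpNorm_dilation (zero_lt_one.trans hp) ha hg hφ h).le)
  simp only [eLpNorm_enorm] at h
  exact h

theorem kruglovNormLorentz_le {B : ℕ → Set unitInterval} (hB : IsPoissonSets B) (hp : 1 < p) :
    kruglovNormLorentz B (rootFun p (zero_lt_one.trans hp)) ≤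
      ∑' k : ℕ, ENNReal.ofReal ((volume (tailSet B (k + 1))).toReal ^ (1 / p)) :=
  kruglovNorm_le_tsum hB
    (NX := fun g => ∫⁻ s in Ioc 0 1, rearr volume g s ∂(rootFun p _).measure)
    (NY := fun g => ∫⁻ s in Ioc 0 1, rearr cubeMeasure g s ∂(rootFun p _).measure)
    (fun _ _ hgh => lintegral_mono (rearr_mono hgh))
    (fun _ hG => lorentz_tsum_le hp hG)
    (fun _ _ _ ha _ _ h => (lorentz_dilation _ ha h).le)

theorem kruglovNormMarcinkiewicz_le {B : ℕ → Set unitInterval} (hB : IsPoissonSets B)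
    (hp : 1 < p) :
    kruglovNormMarcinkiewicz B (rootFun p (zero_lt_one.trans hp)) ≤
      ∑' k : ℕ, ENNReal.ofReal ((volume (tailSet B (k + 1))).toReal ^ (1 / p)) :=
  kruglovNorm_le_tsum hB
    (NX := fun g => ⨆ t ∈ Ioc (0 : ℝ) 1, ENNReal.ofReal (rootFun p _ t / t) *
      ∫⁻ s in Ioc 0 t, rearr volume g s)
    (NY := fun g => ⨆ t ∈ Ioc (0 : ℝ) 1, ENNReal.ofReal (rootFun p _ t / t) *
      ∫⁻ s in Ioc 0 t, rearr cubeMeasure g s)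
    (fun _ _ hgh => iSup₂_mono fun _ _ => by gcongr; exact rearr_mono hgh _)
    (fun _ hG => marcinkiewicz_tsum_le _ hG)
    (fun _ _ _ ha _ _ h => marcinkiewicz_dilation_le hp ha h)

theorem le_kruglovNormLp {B : ℕ → Set unitInterval} (hB : IsPoissonSets B) (hp : 1 < p) {n : ℕ}
    (hn : 1 ≤ n) :
    (n : ℝ≥0∞) * ENNReal.ofReal ((1 / (Real.exp 1 * (n.factorial : ℝ)) / 2) ^ (1 / p)) ≤
      kruglovNormLp B p := by
  have hp0 : 0 < p := zero_lt_one.trans hp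
  have hpne : ENNReal.ofReal p ≠ 0 := by simpa using hp0
  refine le_kruglovNorm hB hn ?_ fun b S g hb _ hS hμ hg => ?_
  · rw [eLpNorm_const _ hpne (NeZero.ne _)]
    simp
  · calc (n : ℝ≥0∞) * ENNReal.ofReal ((b / 2) ^ (1 / p))
        ≤ (n : ℝ≥0∞) * ENNReal.ofReal (b ^ (1 / p)) := by
          gcongr
          linarith
      _ = eLpNorm (S.indicator fun _ => (n : ℝ)) (ENNReal.ofReal p) cubeMeasure := by
          rw [eLpNorm_indicator_const hS hpne ENNReal.ofReal_ne_top, hμ,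
            ENNReal.toReal_ofReal hp0.le, ENNReal.ofReal_rpow_of_pos hb]
          simp
      _ ≤ eLpNorm g (ENNReal.ofReal p) cubeMeasure := by
          refine eLpNorm_mono_enorm fun x => ?_
          by_cases hx : x ∈ S
          · simpa [hx] using hg x hx
          · simp [hx]

theorem le_kruglovNormLorentz {B : ℕ → Set unitInterval} (hB : IsPoissonSets B) (hp : 0 < p)
    {n : ℕ} (hn : 1 ≤ n) :
    (n : ℝ≥0∞) * ENNReal.ofReal ((1 / (Real.exp 1 * (n.factorial : ℝ)) / 2) ^ (1 / p)) ≤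
      kruglovNormLorentz B (rootFun p hp) := by
  have hψ {t : ℝ} (ht : 0 ≤ t) :
      (rootFun p hp).measure (Ioc 0 t) = ENNReal.ofReal (t ^ (1 / p)) := by
    rw [StieltjesFunction.measure_Ioc, rootFun_of_nonneg hp ht, rootFun_of_nonneg hp le_rfl,
      Real.zero_rpow (by positivity), sub_zero]
  refine le_kruglovNorm hB hn ?_ fun b S g hb hb1 _ hμ hg => ?_
  · calc lorentzNorm volume (rootFun p hp) (fun _ => 1)
        ≤ ∫⁻ _ in Ioc (0 : ℝ) 1, 1 ∂(rootFun p hp).measure := lintegral_mono rearr_one_le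
      _ = 1 := by rw [setLIntegral_const, hψ zero_le_one]; simp
  · rw [← hψ (by positivity)]
    exact (setLIntegral_rearr_ge hb hg hμ _).trans
      (lintegral_mono_set (Ioc_subset_Ioc_right (by linarith)))

theorem le_kruglovNormMarcinkiewicz {B : ℕ → Set unitInterval} (hB : IsPoissonSets B)
    (hp : 0 < p) {n : ℕ} (hn : 1 ≤ n) :
    (n : ℝ≥0∞) * ENNReal.ofReal ((1 / (Real.exp 1 * (n.factorial : ℝ)) / 2) ^ (1 / p)) ≤
      kruglovNormMarcinkiewicz B (rootFun p hp) := by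
  have hψ {t : ℝ} (ht : 0 < t) : ENNReal.ofReal (rootFun p hp t / t) * ENNReal.ofReal t =
      ENNReal.ofReal (t ^ (1 / p)) := by
    rw [rootFun_of_nonneg hp ht.le, ← ENNReal.ofReal_mul (by positivity), div_mul_cancel₀ _ ht.ne']
  refine le_kruglovNorm hB hn (iSup₂_le fun t ht => ?_) fun b S g hb hb1 _ hμ hg => ?_
  · calc ENNReal.ofReal (rootFun p hp t / t) *
          ∫⁻ s in Ioc 0 t, decRearr (volume : Measure unitInterval) (fun _ => 1) s
        ≤ ENNReal.ofReal (rootFun p hp t / t) * ∫⁻ _ in Ioc (0 : ℝ) t, 1 := by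
          gcongr
          exact rearr_one_le _
      _ = ENNReal.ofReal (t ^ (1 / p)) := by
          rw [setLIntegral_const, one_mul, Real.volume_Ioc, sub_zero, hψ ht.1]
      _ ≤ 1 := ENNReal.ofReal_le_one.2 (Real.rpow_le_one ht.1.le ht.2 (by positivity))
  · have hb2 : b / 2 ∈ Ioc (0 : ℝ) 1 := ⟨by positivity, by linarith⟩
    calc (n : ℝ≥0∞) * ENNReal.ofReal ((b / 2) ^ (1 / p))
        = ENNReal.ofReal (rootFun p hp (b / 2) / (b / 2)) * (n * volume (Ioc 0 (b / 2))) := by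
          rw [← hψ hb2.1, Real.volume_Ioc, sub_zero]
          ring
      _ ≤ ENNReal.ofReal (rootFun p hp (b / 2) / (b / 2)) *
            ∫⁻ s in Ioc 0 (b / 2), decRearr cubeMeasure g s := by
          gcongr
          exact setLIntegral_rearr_ge hb hg hμ volume
      _ ≤ _ := le_iSup₂ (f := fun t (_ : t ∈ Ioc (0 : ℝ) 1) =>
          ENNReal.ofReal (rootFun p hp t / t) * ∫⁻ s in Ioc 0 t, decRearr cubeMeasure g s) _ hb2

end Bounds

theorem theorem4p5 :
    ∃ α β : ℝ, 0 < α ∧ 0 < β ∧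
      ∀ (B : ℕ → Set unitInterval), IsPoissonSets B → ∀ (p : ℝ) (hp : 1 < p),
        kruglovNormLp B p ∈
          Set.Icc (ENNReal.ofReal (α * (p / Real.log (p + 1))))
            (ENNReal.ofReal (β * (p / Real.log (p + 1)))) ∧
        kruglovNormLorentz B (rootFun p (zero_lt_one.trans hp)) ∈
          Set.Icc (ENNReal.ofReal (α * (p / Real.log (p + 1))))
            (ENNReal.ofReal (β * (p / Real.log (p + 1)))) ∧
        kruglovNormMarcinkiewicz B (rootFun p (zero_lt_one.trans hp)) ∈
          Set.Icc (ENNReal.ofReal (α * (p / Real.log (p + 1))))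
            (ENNReal.ofReal (β * (p / Real.log (p + 1)))) := by
  refine ⟨Real.exp (-4) / (2 * Real.exp 1), 2 * Real.exp 2, by positivity, by positivity,
    fun B hB p hp => ?_⟩
  obtain ⟨n, hn, hlow⟩ := exists_le_natCast_mul_rpow hp
  have hlow' : ENNReal.ofReal (Real.exp (-4) / (2 * Real.exp 1) * (p / Real.log (p + 1))) ≤
      (n : ℝ≥0∞) * ENNReal.ofReal ((1 / (Real.exp 1 * (n.factorial : ℝ)) / 2) ^ (1 / p)) := by
    rw [← ENNReal.ofReal_natCast, ← ENNReal.ofReal_mul (by positivity)]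
    exact ENNReal.ofReal_le_ofReal hlow
  have hup := tsum_ofReal_rpow_le hp (a := fun k => (volume (tailSet B (k + 1))).toReal)
    (fun k => ENNReal.toReal_nonneg)
    fun k => ENNReal.toReal_le_of_le_ofReal (by positivity) (volume_tailSet_le hB (by omega))
  exact ⟨⟨hlow'.trans (le_kruglovNormLp hB hp hn), (kruglovNormLp_le hB hp).trans hup⟩,
    ⟨hlow'.trans (le_kruglovNormLorentz hB _ hn), (kruglovNormLorentz_le hB hp).trans hup⟩,
    ⟨hlow'.trans (le_kruglovNormMarcinkiewicz hB _ hn),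
      (kruglovNormMarcinkiewicz_le hB hp).trans hup⟩⟩
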